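/- Let $I$ be a set and let $\mathcal A$ be a finite set of finite subsets of $I$, regarded as a poset category with an arrow $\alpha\to\beta$ exactly when $\beta\subseteq\alpha$. Assume the weak intersection property: $\alpha\cap\beta\in\mathcal A$ whenever $\alpha,\beta\in\mathcal A$ and $\alpha\cap\beta\neq\emptyset$. Let $(E_i)_{i\in I}$ be finite non-empty sets, $E_\alpha=\prod_{i\in\alpha}E_i$, $N_\alpha=|E_\alpha|$, and let $\mathbb K$ be a field. Give $\mathcal A$ the lower Alexandrov topology, with basis $U_\alpha=\{\beta\in\mathcal A:\alpha\to\beta\}$, and let $\mathcal U_{\mathcal A}=\{U_\alpha\}_{\alpha\in\mathcal A}$. A covariant functor $G$ from $\mathcal A$ to $\mathbb K$-vector spaces induces the sheaf $G(U)=\varprojlim_{\alpha\in U}G_\alpha$, and $H^k(\mathcal U_{\mathcal A};G)$ denotes the Čech cohomology of this sheaf for the covering $\mathcal U_{\mathcal A}$. Let $F$ be the free sheaf, given by $F_\alpha=\mathbb K^{(E_\alpha)}$ with the maps induced by the projections $E_\alpha\to E_\beta$, and let $\overline F\subseteq F$ be the restricted free sheaf, where $\overline F_\alpha$ consists of the vectors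 whose coordinates have sum $0$. Let $\mu_{\alpha\beta}$ be the Möbius function of $\mathcal A$, i.e. $\mu_{\alpha\beta}=0$ if $\alpha\not\to\beta$, and $\sum_{\beta:\,\alpha\to\beta\to\gamma}\mu_{\alpha\beta}=\delta_{\alpha\gamma}$ whenever $\alpha\to\gamma$. Let $\chi(\mathcal A)=\sum_{\alpha,\beta\in\mathcal A}\mu_{\alpha\beta}$ be the Euler characteristic of $\mathcal A$. Then every $H^k(\mathcal U_{\mathcal A};F)$ is finite dimensional, only finitely many of them are non-zero, $H^0(\mathcal U_{\mathcal A};\overline F)$ is finite dimensional, and $$\chi(\mathcal A;F):=\sum_{k=0}^{\infty}(-1)^k\dim_{\mathbb K}H^k(\mathcal U_{\mathcal A};F)=\sum_{\alpha,\beta\in\mathcal A}\mu_{\alpha\beta}N_\beta=\dim_{\mathbb K}H^0(\mathcal U_{\mathcal A};\overline F)+\chi(\mathcal A).$$ Moreover $\chi(\mathcal A)$ equals the Euler characteristic $\sum_k(-1)^k\dim_{\mathbb K}H^k$ of the Čech cohomology, with constant coefficients $\mathbb K$, of the canonical covering of $\mathcal A$ by the basic open sets of the lower Alexandrov topology; the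 same holds for the upper Alexandrov topology (the lower one of $\mathcal A^{\mathrm{op}}$); in both cases all the cohomology spaces are finite dimensional and only finitely many are non-zero. Finally $\chi(\mathcal A)=\sum_{k\ge 0}(-1)^k r_k$, where $r_k$ is the number of non-degenerate chains $\alpha_0\to\cdots\to\alpha_k$ in $\mathcal A$, i.e. the Euler characteristic of the nerve of $\mathcal A$. -/

import Mathlib

noncomputable section

universe u v w z

/-! ### Sheaves on a poset with its lower Alexandrov topology

A poset `P` is regarded as a category with an arrow `a ⟶ b` exactly when `b ≤ a`. -/

/-- A covariant functor (copresheaf) of `K`-vector spaces on the poset `P`, where there is an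
arrow `a ⟶ b` exactly when `b ≤ a`. -/
structure Copresheaf (K : Type u) [Field K] (P : Type v) [PartialOrder P] where
  /-- The vector space attached to an element. -/
  obj : P → Type w
  [addCommGroup : ∀ a, AddCommGroup (obj a)]
  [module : ∀ a, Module K (obj a)]
  /-- The linear map attached to an arrow `a ⟶ b`. -/
  map : ∀ {a b : P}, b ≤ a → (obj a →ₗ[K] obj b)
  map_refl : ∀ a : P, map (le_refl a) = LinearMap.id
  map_comp : ∀ {a b c : P} (hba : b ≤ a) (hcb : c ≤ b),
    map hcb ∘ₗ map hba = map (hcb.trans hba)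

attribute [instance] Copresheaf.addCommGroup Copresheaf.module

namespace Copresheaf

variable {K : Type u} [Field K] {P : Type v} [PartialOrder P]

/-- The open sets of the lower Alexandrov topology on `P` are the lower sets. The sheaf induced by
the copresheaf `G` has as sections over an open set `U` the coherent families
`(s a)_{a ∈ U}`, `s a ∈ G a`, i.e. the limit of `G` over `U`. -/
def sections (G : Copresheaf.{u, v, w} K P) (U : LowerSet P) :
    Submodule K (∀ a : U, G.obj a) where
  carrier := {s | ∀ (a b : U) (h : (b : P) ≤ a), G.map h (s a) = s b}
  add_mem' := by
    intro s t hs ht a b h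
    simp [hs a b h, ht a b h]
  zero_mem' := by
    intro a b h
    simp
  smul_mem' := by
    intro c s hs a b h
    simp [hs a b h]

/-- The vector space `G(U)` of sections over the open set `U`. -/
def Section (G : Copresheaf.{u, v, w} K P) (U : LowerSet P) : Type (max v w) :=
  G.sections U

instance (G : Copresheaf.{u, v, w} K P) (U : LowerSet P) : AddCommGroup (G.Section U) :=
  inferInstanceAs (AddCommGroup (G.sections U))

instance (G : Copresheaf.{u, v, w} K P) (U : LowerSet P) : Module K (G.Section U) :=
  inferInstanceAs (Module K (G.sections U))

/-- Restriction of sections to a smaller open set. -/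
def restrict (G : Copresheaf.{u, v, w} K P) {U V : LowerSet P} (h : V ≤ U) :
    G.Section U →ₗ[K] G.Section V where
  toFun s := ⟨fun a => s.1 ⟨a.1, h a.2⟩, fun a b hab => s.2 ⟨a.1, h a.2⟩ ⟨b.1, h b.2⟩ hab⟩
  map_add' _ _ := rfl
  map_smul' _ _ := rfl

end Copresheaf

/-! ### Čech cohomology of the canonical covering by the principal open sets -/

/-- The intersection of the basic open sets `U_a = {b | a ⟶ b} = {b | b ≤ a}`, for `a` in a finite
sequence of elements of `P`. -/
def coverInter {P : Type v} [PartialOrder P] {n : ℕ} (u : Fin (n + 1) → P) : LowerSet P :=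
  ⨅ i, LowerSet.Iic (u i)

/-- The `n`-simplices of the nerve of the covering `{U_a}`: the sequences of length `n + 1` of
members of the covering whose intersection is non-empty. -/
def CechSimplex (P : Type v) [PartialOrder P] (n : ℕ) : Type v :=
  {u : Fin (n + 1) → P // (coverInter u : Set P).Nonempty}

theorem coverInter_le_face {P : Type v} [PartialOrder P] {n : ℕ} (u : Fin (n + 2) → P)
    (i : Fin (n + 2)) : coverInter u ≤ coverInter (u ∘ i.succAbove) :=
  le_iInf fun j => iInf_le _ (i.succAbove j)

/-- The `i`-th face: omit the `i`-th member of the sequence. -/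
def CechSimplex.face {P : Type v} [PartialOrder P] {n : ℕ} (i : Fin (n + 2))
    (u : CechSimplex P (n + 1)) : CechSimplex P n :=
  ⟨u.1 ∘ i.succAbove, u.2.mono (coverInter_le_face u.1 i)⟩

namespace Copresheaf

variable {K : Type u} [Field K] {P : Type v} [PartialOrder P]

/-- Čech cochains of degree `n` of the sheaf induced by `G`, for the covering `{U_a}`. -/
abbrev CechCochain (G : Copresheaf.{u, v, w} K P) (n : ℕ) : Type (max v w) :=
  ∀ u : CechSimplex P n, G.Section (coverInter u.1)

/-- The Čech coboundary: the alternating sum of the restrictions of the values on the faces. -/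
def cechDelta (G : Copresheaf.{u, v, w} K P) (n : ℕ) :
    G.CechCochain n →ₗ[K] G.CechCochain (n + 1) :=
  LinearMap.pi fun u => ∑ i : Fin (n + 2),
    (-1 : K) ^ (i : ℕ) •
      (G.restrict (coverInter_le_face u.1 i) ∘ₗ LinearMap.proj (CechSimplex.face i u))

/-- Čech cocycles of degree `n`. -/
abbrev cechCocycle (G : Copresheaf.{u, v, w} K P) (n : ℕ) : Submodule K (G.CechCochain n) :=
  LinearMap.ker (G.cechDelta n)

/-- Čech coboundaries of degree `n`; there are none but zero in degree `0`. -/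
def cechCoboundary (G : Copresheaf.{u, v, w} K P) : ∀ n : ℕ, Submodule K (G.CechCochain n)
  | 0 => ⊥
  | n + 1 => LinearMap.range (G.cechDelta n)

/-- The Čech cohomology `H^n` of the covering `{U_a}` with values in the sheaf induced by `G`:
cocycles modulo coboundaries. -/
abbrev CechH (G : Copresheaf.{u, v, w} K P) (n : ℕ) : Type (max v w) :=
  G.cechCocycle n ⧸ (G.cechCoboundary n).submoduleOf (G.cechCocycle n)

/-- All the Čech cohomology spaces are finite dimensional and only finitely many are non-zero, so
that the Euler characteristic makes sense. -/
def HasFiniteCechCohomology (G : Copresheaf.{u, v, w} K P) : Prop :=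
  (∀ k, FiniteDimensional K (G.CechH k)) ∧ ∃ d : ℕ, ∀ k, d < k → Subsingleton (G.CechH k)

/-- The Euler characteristic `∑ₖ (-1)^k dim H^k` of the Čech cohomology. -/
def cechEuler (G : Copresheaf.{u, v, w} K P) : ℤ :=
  ∑ᶠ k : ℕ, (-1 : ℤ) ^ k * (Module.finrank K (G.CechH k) : ℤ)

/-- The constant copresheaf `K`. -/
def const (K : Type u) [Field K] (P : Type v) [PartialOrder P] : Copresheaf.{u, v, u} K P where
  obj _ := K
  map _ := LinearMap.id
  map_refl _ := rfl
  map_comp _ _ := rfl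

end Copresheaf

/-! ### Hypergraphs and free sheaves

The elements of a finite hypergraph `𝒜` are finite subsets of `I`; the poset `𝒜` is ordered by
inclusion, so that there is an arrow `α ⟶ β` exactly when `β ⊆ α`. -/

/-- The weak intersection property: if two elements of `𝒜` have non-empty intersection, then
their intersection belongs to `𝒜`. -/
def WeakIntersectionProperty {I : Type u} [DecidableEq I] (𝒜 : Finset (Finset I)) : Prop :=
  ∀ α ∈ 𝒜, ∀ β ∈ 𝒜, (α ∩ β).Nonempty → α ∩ β ∈ 𝒜

/-- `E_α`, the product of the sets `E i` for `i ∈ α`. -/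
abbrev Outcome {I : Type u} (E : I → Type v) (α : Finset I) : Type (max u v) :=
  ∀ i : α, E i

/-- The free copresheaf: `F_α = K^(E_α)` is the vector space freely generated by `E_α`, and for
`β ⊆ α` the map `F_α → F_β` is induced by the projection `E_α → E_β`. -/
def freeCopresheaf (K : Type w) [Field K] {I : Type u} (𝒜 : Finset (Finset I)) (E : I → Type v) :
    Copresheaf.{w, u, max u v w} K 𝒜 where
  obj α := Outcome E α.1 →₀ K
  map {α β} h := Finsupp.lmapDomain K K (Finset.restrict₂ (π := E) (s := β.1) (t := α.1) h)
  map_refl _ := Finsupp.lmapDomain_id K K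
  map_comp _ _ := (Finsupp.lmapDomain_comp K K _ _).symm

/-- The sum of the coordinates, on a freely generated vector space. -/
def coordSum (K : Type w) [Field K] (X : Type z) : (X →₀ K) →ₗ[K] K :=
  Finsupp.linearCombination K fun _ => (1 : K)

theorem coordSum_lmapDomain (K : Type w) [Field K] {X Y : Type z} (f : X → Y) (x : X →₀ K) :
    coordSum K Y (Finsupp.lmapDomain K K f x) = coordSum K X x := by
  simp [coordSum, Finsupp.linearCombination_mapDomain, Function.comp_def]

/-- The restricted free copresheaf: `F̄_α ⊆ F_α` is the subspace of the vectors whose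
coordinates have sum zero, with the maps induced by those of the free copresheaf. -/
def restrictedFreeCopresheaf (K : Type w) [Field K] {I : Type u} (𝒜 : Finset (Finset I))
    (E : I → Type v) : Copresheaf.{w, u, max u v w} K 𝒜 where
  obj α := LinearMap.ker (coordSum K (Outcome E α.1))
  map {α β} h := (Finsupp.lmapDomain K K
      (Finset.restrict₂ (π := E) (s := β.1) (t := α.1) h)).restrict fun x hx => by
    rw [LinearMap.mem_ker] at hx ⊢
    exact (coordSum_lmapDomain K _ x).trans hx
  map_refl α := LinearMap.ext fun x =>
    Subtype.ext (LinearMap.congr_fun ((freeCopresheaf K 𝒜 E).map_refl α) x.1)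
  map_comp hba hcb := LinearMap.ext fun x =>
    Subtype.ext (LinearMap.congr_fun ((freeCopresheaf K 𝒜 E).map_comp hba hcb) x.1)

/-- The Möbius coefficient `μ_{αβ}` of `𝒜`, which vanishes unless `α ⟶ β`, i.e. `β ⊆ α`. It is
the value at `(β, α)` of the Möbius function for the order `⊆`, in which `β` is the smaller
element. -/
def moebiusCoeff {I : Type u} [DecidableEq I] (𝒜 : Finset (Finset I)) (α β : 𝒜) : ℤ :=
  IncidenceAlgebra.mu ℤ β α

/-- The Euler characteristic `χ(𝒜)` of the finite poset `𝒜`. -/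
def posetEuler {I : Type u} [DecidableEq I] (𝒜 : Finset (Finset I)) : ℤ :=
  ∑ α : 𝒜, ∑ β : 𝒜, moebiusCoeff 𝒜 α β

/-- The Euler characteristic of the nerve of `𝒜`: the alternating sum of the numbers of
non-degenerate chains of length `k` (i.e. with `k + 1` elements, so that `k < |𝒜|`). -/
def nerveEuler {I : Type u} (𝒜 : Finset (Finset I)) : ℤ :=
  ∑ k ∈ Finset.range 𝒜.card,
    (-1 : ℤ) ^ k * (Nat.card {c : Fin (k + 1) → 𝒜 // StrictAnti c} : ℤ)

end

noncomputable section

universe u v w x z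

/-! ### Sums over a finite poset -/

/-! Embed a copresheaf `G` into the copresheaf `J` of arbitrary families, J_a = ∏_{b ≤ a} G_b, with
quotient `Q`. Non-empty intersections of basic open sets are again principal, so sections over them
are values of the copresheaf, and 0 → G → J → Q → 0 gives a short exact sequence of Čech complexes.
The complex of `J` is exact in positive degrees, by a contracting homotopy (`godement_exact`), and
H^0(J) has dimension ∑ dim G_a. Hence χ(G) = ∑ dim G_a − χ(Q) (`HasIndex.of_godementQuot`).

Passing to `Q` kills the values at the minimal elements of the support, so after finitely many steps
the copresheaf is zero. Going back up, one obtains a function `f` with dim G_b = ∑_{c ≤ b} f(c) and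
χ(G) = ∑ f; Möbius inversion turns this into the index formula. It applies to the free sheaf and to
constant coefficients, and also to the dual poset, because bounded infima in a finite poset give
bounded suprema.

For the restricted free sheaf, coherent families strictly below an element extend to it
(`restrictedFreeCopresheaf_isExtendable`). Filtering by one element at a time writes both dim H^0
and each dim G_b as sums of dimensions of the same vanishing subspaces, and Möbius inversion gives
dim H^0 = ∑ μ_{αβ}(N_β − 1). The nerve is handled by a telescoping sum over chains. -/

open Classical in
/-- The sum of the values of `f` at the elements below `b`. -/
def zetaSum {P : Type v} [PartialOrder P] [Fintype P] (f : P → ℤ) (b : P) : ℤ :=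
  ∑ c : P, if c ≤ b then f c else 0

/-- Möbius inversion: for fixed `a` the inner sum over `b` is already `f a`. -/
theorem sum_mu_mul_zetaSum {P : Type v} [PartialOrder P] [Fintype P] [LocallyFiniteOrder P]
    [DecidableEq P] (f : P → ℤ) :
    ∑ a : P, ∑ b : P, IncidenceAlgebra.mu ℤ b a * zetaSum f b = ∑ c : P, f c := by
  classical
  have key : ∀ a c : P, ∑ b : P, IncidenceAlgebra.mu ℤ b a * (if c ≤ b then f c else 0) =
      if c = a then f c else 0 := by
    intro a c
    have h := IncidenceAlgebra.sum_Icc_mu_left (𝕜 := ℤ) c a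
    calc ∑ b : P, IncidenceAlgebra.mu ℤ b a * (if c ≤ b then f c else 0)
        = ∑ b ∈ Finset.Icc c a, IncidenceAlgebra.mu ℤ b a * f c := by
          symm
          rw [← Finset.sum_filter_add_sum_filter_not Finset.univ (· ∈ Finset.Icc c a),
            Finset.sum_eq_zero (s := Finset.univ.filter (· ∉ Finset.Icc c a)), add_zero]
          · refine Finset.sum_congr (by ext; simp) fun b hb => ?_
            rw [if_pos (Finset.mem_Icc.1 (Finset.mem_filter.1 hb).2).1]
          · intro b hb
            simp only [Finset.mem_filter, Finset.mem_univ, true_and, Finset.mem_Icc, not_and] at hb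
            split_ifs with hcb
            · rw [IncidenceAlgebra.apply_eq_zero_of_not_le (hb hcb), zero_mul]
            · rw [mul_zero]
      _ = if c = a then f c else 0 := by
          rw [← Finset.sum_mul, h]
          split_ifs <;> simp
  simp only [zetaSum, Finset.mul_sum]
  calc ∑ a : P, ∑ b : P, ∑ c : P, IncidenceAlgebra.mu ℤ b a * (if c ≤ b then f c else 0)
      = ∑ a : P, ∑ c : P, if c = a then f c else 0 := by
        refine Finset.sum_congr rfl fun a _ => ?_
        rw [Finset.sum_comm]
        exact Finset.sum_congr rfl fun c _ => key a c
    _ = ∑ c : P, f c := by simp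

/-! ### Sums over non-degenerate chains. -/

/-- Summation over the strictly decreasing sequences of a fixed length, of the value of `f` at the
last term. -/
def chainSum {P : Type v} [PartialOrder P] [Fintype P] (k : ℕ) (f : P → ℤ) : ℤ :=
  ∑ᶠ c : {c : Fin (k + 1) → P // StrictAnti c}, f (c.1 (Fin.last k))

theorem strictAnti_snoc_iff {P : Type v} [Preorder P] {k : ℕ} (c : Fin (k + 1) → P) (x : P) :
    StrictAnti (Fin.snoc c x : Fin (k + 2) → P) ↔ StrictAnti c ∧ x < c (Fin.last k) := by
  constructor
  · intro h
    refine ⟨fun i j hij => ?_, ?_⟩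
    · simpa using h (Fin.castSucc_lt_castSucc_iff.2 hij)
    · simpa using h (Fin.castSucc_lt_last (Fin.last k))
  · rintro ⟨h, hx⟩
    refine Fin.strictAnti_iff_succ_lt.2 fun i => ?_
    induction i using Fin.lastCases with
    | last => simpa using hx
    | cast i =>
      rw [Fin.succ_castSucc, Fin.snoc_castSucc, Fin.snoc_castSucc]
      exact h (Fin.castSucc_lt_succ)

/-- A strictly decreasing sequence is a shorter one with an additional smaller last term. -/
def strictAntiSnocEquiv (P : Type v) [PartialOrder P] (k : ℕ) :
    {c : Fin (k + 2) → P // StrictAnti c} ≃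
      Σ c : {c : Fin (k + 1) → P // StrictAnti c}, {x : P // x < c.1 (Fin.last k)} where
  toFun c := ⟨⟨Fin.init c.1, fun _ _ h => c.2 (Fin.castSucc_lt_castSucc_iff.2 h)⟩,
    ⟨c.1 (Fin.last _), c.2 (Fin.castSucc_lt_last _)⟩⟩
  invFun p := ⟨Fin.snoc p.1.1 p.2.1, (strictAnti_snoc_iff _ _).2 ⟨p.1.2, p.2.2⟩⟩
  left_inv c := Subtype.ext (Fin.snoc_init_self c.1)
  right_inv p := by
    rcases p with ⟨⟨c, hc⟩, x, hx⟩
    have h1 : Fin.init (Fin.snoc c x : Fin (k + 2) → P) = c :=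
      Fin.init_snoc (α := fun _ => P) x c
    have h2 : (Fin.snoc c x : Fin (k + 2) → P) (Fin.last _) = x :=
      Fin.snoc_last (α := fun _ => P) x c
    refine Sigma.ext (Subtype.ext h1) ?_
    refine (Subtype.heq_iff_coe_eq fun y => ?_).2 h2
    change y < Fin.init (Fin.snoc c x : Fin (k + 2) → P) (Fin.last k) ↔ y < c (Fin.last k)
    rw [h1]

theorem zetaSum_eq_add {P : Type v} [PartialOrder P] [Fintype P] (f : P → ℤ) (b : P) :
    zetaSum f b = f b + ∑ᶠ x : {x : P // x < b}, f x := by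
  classical
  rw [zetaSum, finsum_eq_sum_of_fintype,
    ← Finset.sum_subtype (Finset.univ.filter (· < b)) (by simp) f, ← Finset.sum_filter]
  have : (Finset.univ.filter (· ≤ b)) = insert b (Finset.univ.filter (· < b)) := by
    ext x
    simp [le_iff_eq_or_lt]
  rw [this, Finset.sum_insert (by simp)]

/-- An element below the last term of a chain either equals that term or prolongs the chain by one.
-/
theorem chainSum_zetaSum {P : Type v} [PartialOrder P] [Fintype P] (k : ℕ) (f : P → ℤ) :
    chainSum k (zetaSum f) = chainSum k f + chainSum (k + 1) f := by
  classical
  simp only [chainSum, zetaSum_eq_add, finsum_eq_sum_of_fintype, Finset.sum_add_distrib]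
  congr 1
  rw [← Fintype.sum_sigma' fun (c : {c : Fin (k + 1) → P // StrictAnti c})
    (x : {x : P // x < c.1 (Fin.last k)}) => f x]
  exact (Fintype.sum_equiv (strictAntiSnocEquiv P k) _ _ fun c => rfl).symm

theorem chainSum_zero {P : Type v} [PartialOrder P] [Fintype P] (f : P → ℤ) :
    chainSum 0 f = ∑ c : P, f c := by
  classical
  rw [chainSum, finsum_eq_sum_of_fintype]
  refine Fintype.sum_equiv ⟨fun c => c.1 0, fun x => ⟨fun _ => x, fun i j h => by omega⟩,
    fun c => Subtype.ext (funext fun i => congrArg c.1 (Fin.ext (by simp))), fun x => rfl⟩ _ _ ?_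
  intro c
  rfl

theorem chainSum_eq_zero {P : Type v} [PartialOrder P] [Fintype P] {k : ℕ}
    (hk : Fintype.card P ≤ k) (f : P → ℤ) : chainSum k f = 0 := by
  have : IsEmpty {c : Fin (k + 1) → P // StrictAnti c} := ⟨fun c => by
    have := Fintype.card_le_of_injective c.1 c.2.injective
    simp at this
    omega⟩
  exact finsum_of_isEmpty _

/-- By `chainSum_zetaSum` the alternating sum telescopes, and no strict chain has more elements than
`P`. If `zetaSum f` is constantly 1, the left side is the Euler characteristic of the nerve. -/
theorem sum_chainSum_zetaSum {P : Type v} [PartialOrder P] [Fintype P] (f : P → ℤ) :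
    ∑ k ∈ Finset.range (Fintype.card P), (-1 : ℤ) ^ k * chainSum k (zetaSum f) =
      ∑ c : P, f c := by
  have h : ∀ n : ℕ, ∑ k ∈ Finset.range n, (-1 : ℤ) ^ k * chainSum k (zetaSum f) =
      chainSum 0 f - (-1) ^ n * chainSum n f := by
    intro n
    induction n with
    | zero => simp
    | succ n ih => rw [Finset.sum_range_succ, ih, chainSum_zetaSum]; ring
  rw [h, chainSum_eq_zero le_rfl, chainSum_zero]
  ring

theorem chainSum_one {P : Type v} [PartialOrder P] [Fintype P] (k : ℕ) :
    chainSum k (fun _ : P => 1) = Nat.card {c : Fin (k + 1) → P // StrictAnti c} := by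
  classical
  rw [chainSum, finsum_eq_sum_of_fintype]
  simp [Nat.card_eq_fintype_card]

/-! ### Posets in which two elements with a common lower bound have an infimum -/

/-- Two elements with a common lower bound have an infimum. -/
def HasBoundedInf (P : Type v) [PartialOrder P] : Prop :=
  ∀ a b c : P, c ≤ a → c ≤ b → ∃ m, IsGLB {a, b} m

theorem HasBoundedInf.dual {P : Type v} [PartialOrder P] [Finite P] (h : HasBoundedInf P) :
    HasBoundedInf Pᵒᵈ := by
  intro a b c hca hcb
  -- A minimal common upper bound `m` is least: the infimum of `m` and any other common upper bound
  -- `s` exists, as `a` lies below both, and it is again a common upper bound.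
  obtain ⟨m, hm⟩ := (Set.toFinite
    {s : P | OrderDual.ofDual a ≤ s ∧ OrderDual.ofDual b ≤ s}).exists_minimal ⟨OrderDual.ofDual c, hca, hcb⟩
  refine ⟨OrderDual.toDual m, ?_, ?_⟩
  · rintro x (rfl | rfl)
    · exact hm.prop.1
    · exact hm.prop.2
  · intro s hs
    have ha : OrderDual.ofDual a ≤ OrderDual.ofDual s := hs (Set.mem_insert _ _)
    have hb : OrderDual.ofDual b ≤ OrderDual.ofDual s := hs (Set.mem_insert_of_mem _ rfl)
    obtain ⟨g, hg⟩ := h m (OrderDual.ofDual s) _ hm.prop.1 ha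
    have hgm : g ≤ m := hg.1 (Set.mem_insert _ _)
    have hag : OrderDual.ofDual a ≤ g := hg.2 (by
      rintro x (rfl | rfl); exacts [hm.prop.1, ha])
    have hbg : OrderDual.ofDual b ≤ g := hg.2 (by
      rintro x (rfl | rfl); exacts [hm.prop.2, hb])
    have hmg : m ≤ g := hm.le_of_le ⟨hag, hbg⟩ hgm
    exact hmg.trans (hg.1 (Set.mem_insert_of_mem _ rfl))

theorem mem_coverInter {P : Type v} [PartialOrder P] {n : ℕ} {u : Fin (n + 1) → P} {a : P} :
    a ∈ coverInter u ↔ ∀ i, a ≤ u i := by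
  simp [coverInter]

/-- Infima are taken one at a time; the point `c` of the intersection stays a common lower bound
throughout. -/
theorem HasBoundedInf.coverInter_eq_Iic {P : Type v} [PartialOrder P] (h : HasBoundedInf P)
    {n : ℕ} (u : Fin (n + 1) → P) (hu : (coverInter u : Set P).Nonempty) :
    ∃ m, coverInter u = LowerSet.Iic m := by
  obtain ⟨c, hc⟩ := hu
  rw [SetLike.mem_coe, mem_coverInter] at hc
  induction n with
  | zero => exact ⟨u 0, by ext; simp [mem_coverInter]⟩
  | succ n ih =>
    have hcm : c ∈ coverInter (Fin.tail u) := mem_coverInter.2 fun i => hc i.succ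
    obtain ⟨m, hm⟩ := ih (Fin.tail u) (mem_coverInter.1 hcm)
    rw [hm] at hcm
    obtain ⟨g, hg⟩ := h (u 0) m c (hc 0) hcm
    refine ⟨g, SetLike.ext fun x => ?_⟩
    have hx : x ∈ coverInter (Fin.tail u) ↔ x ≤ m := by rw [hm]; rfl
    rw [mem_coverInter, Fin.forall_fin_succ, LowerSet.mem_Iic_iff, le_isGLB_iff hg]
    constructor
    · rintro ⟨h0, h1⟩ y (rfl | rfl)
      exacts [h0, hx.1 (mem_coverInter.2 h1)]
    · intro hl
      exact ⟨hl (Set.mem_insert _ _),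
        mem_coverInter.1 (hx.2 (hl (Set.mem_insert_of_mem _ rfl)))⟩

theorem WeakIntersectionProperty.hasBoundedInf {I : Type u} [DecidableEq I]
    {𝒜 : Finset (Finset I)} (h : WeakIntersectionProperty 𝒜) : HasBoundedInf 𝒜 := by
  intro a b c hca hcb
  by_cases hab : (a.1 ∩ b.1).Nonempty
  · refine ⟨⟨_, h _ a.2 _ b.2 hab⟩, ?_, ?_⟩
    · rintro x (rfl | rfl)
      exacts [Finset.inter_subset_left, Finset.inter_subset_right]
    · intro x hx
      exact Finset.subset_inter (hx (Set.mem_insert _ _)) (hx (Set.mem_insert_of_mem _ rfl))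
  -- For disjoint `a`, `b` every common lower bound is the empty set, so `c` is the only one.
  · refine ⟨c, ?_, ?_⟩
    · rintro x (rfl | rfl)
      exacts [hca, hcb]
    · intro x hx
      have : x.1 ⊆ a.1 ∩ b.1 :=
        Finset.subset_inter (hx (Set.mem_insert _ _)) (hx (Set.mem_insert_of_mem _ rfl))
      rw [Finset.not_nonempty_iff_eq_empty.1 hab] at this
      exact this.trans (Finset.empty_subset _)

/-! ### The Čech complex -/

namespace Copresheaf

variable {K : Type u} [Field K] {P : Type v} [PartialOrder P]

/-- The value of a section at a point. -/
def eval (G : Copresheaf.{u, v, w} K P) {U : LowerSet P} (a : P) (ha : a ∈ U) :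
    G.Section U →ₗ[K] G.obj a where
  toFun s := s.1 ⟨a, ha⟩
  map_add' _ _ := rfl
  map_smul' _ _ := rfl

variable {G : Copresheaf.{u, v, w} K P}

theorem section_ext {U : LowerSet P} {s t : G.Section U}
    (h : ∀ a (ha : a ∈ U), G.eval a ha s = G.eval a ha t) : s = t :=
  Subtype.ext (funext fun a => h a.1 a.2)

theorem map_eval {U : LowerSet P} (s : G.Section U) {a b : P} (ha : a ∈ U) (hba : b ≤ a) :
    G.map hba (G.eval a ha s) = G.eval b (U.lower hba ha) s :=
  s.2 ⟨a, ha⟩ ⟨b, U.lower hba ha⟩ hba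

theorem eval_restrict {U V : LowerSet P} (h : V ≤ U) (s : G.Section U) {a : P} (ha : a ∈ V) :
    G.eval a ha (G.restrict h s) = G.eval a (h ha) s := rfl

/-- The section with given coherent values. -/
def mkSection {U : LowerSet P} (s : ∀ a, a ∈ U → G.obj a)
    (hs : ∀ a b (ha : a ∈ U) (hba : b ≤ a), G.map hba (s a ha) = s b (U.lower hba ha)) :
    G.Section U :=
  ⟨fun a => s a.1 a.2, fun a b h => hs a.1 b.1 a.2 h⟩

@[simp]
theorem eval_mkSection {U : LowerSet P} (s : ∀ a, a ∈ U → G.obj a)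
    (hs : ∀ a b (ha : a ∈ U) (hba : b ≤ a), G.map hba (s a ha) = s b (U.lower hba ha))
    (a : P) (ha : a ∈ U) : G.eval a ha (mkSection s hs) = s a ha := rfl

theorem face_mem {n : ℕ} {u : CechSimplex P (n + 1)} {a : P} (ha : a ∈ coverInter u.1)
    (i : Fin (n + 2)) : a ∈ coverInter (u.face i).1 :=
  coverInter_le_face u.1 i ha

theorem eval_cechDelta {n : ℕ} (c : G.CechCochain n) (u : CechSimplex P (n + 1)) (a : P)
    (ha : a ∈ coverInter u.1) :
    G.eval a ha (G.cechDelta n c u) =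
      ∑ i : Fin (n + 2), (-1 : K) ^ (i : ℕ) • G.eval a (face_mem ha i) (c (u.face i)) := by
  simp only [cechDelta, LinearMap.pi_apply, LinearMap.sum_apply, LinearMap.smul_apply, map_sum,
    map_smul]
  rfl

/-- The simplicial identity, written through the involution on pairs `(i, j)` that cancels the terms
of the squared coboundary. -/
theorem face_face {n : ℕ} (u : CechSimplex P (n + 2)) (i : Fin (n + 3)) (j : Fin (n + 2)) :
    (u.face (i.succAbove j)).face (j.predAbove i) = (u.face i).face j :=
  Subtype.ext (funext fun k =>
    congrArg u.1 (Fin.succAbove_succAbove_succAbove_predAbove i j k))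

theorem eval_congr {n : ℕ} (c : G.CechCochain n) {u u' : CechSimplex P n} (h : u = u') (a : P)
    (ha : a ∈ coverInter u.1) (ha' : a ∈ coverInter u'.1) :
    G.eval a ha (c u) = G.eval a ha' (c u') := by
  subst h; rfl

theorem cechDelta_cechDelta (n : ℕ) (c : G.CechCochain n) :
    G.cechDelta (n + 1) (G.cechDelta n c) = 0 := by
  refine funext fun u => section_ext fun a ha => ?_
  rw [eval_cechDelta]
  simp only [eval_cechDelta, Finset.smul_sum, smul_smul, ← pow_add, Pi.zero_apply, map_zero]
  rw [← Fintype.sum_prod_type' fun (i : Fin (n + 3)) (j : Fin (n + 2)) =>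
    (-1 : K) ^ ((i : ℕ) + j) • G.eval a (face_mem (face_mem ha i) j) (c ((u.face i).face j))]
  refine Finset.sum_ninvolution (fun x => (x.1.succAbove x.2, x.2.predAbove x.1)) ?_ ?_ ?_ ?_
  · rintro ⟨i, j⟩
    simp only
    rw [Fin.neg_one_pow_succAbove_add_predAbove, neg_smul,
      eval_congr c (face_face u i j) a _ (face_mem (face_mem ha i) j), add_neg_cancel]
  · rintro ⟨i, j⟩ _ h
    exact Fin.succAbove_ne i j (congrArg Prod.fst h)
  · simp
  · rintro ⟨i, j⟩
    simp only [Fin.succAbove_succAbove_predAbove, Fin.predAbove_predAbove_succAbove]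

/-! ### Finite dimensionality and dimension counts. -/

/-- All the vector spaces of the copresheaf are finite dimensional. -/
def IsFinite (G : Copresheaf.{u, v, w} K P) : Prop :=
  ∀ a, FiniteDimensional K (G.obj a)

theorem IsFinite.section [Finite P] (hG : G.IsFinite) (U : LowerSet P) :
    FiniteDimensional K (G.Section U) := by
  have := fun a => hG a
  exact inferInstanceAs (FiniteDimensional K (G.sections U))

instance [Finite P] (n : ℕ) : Finite (CechSimplex P n) :=
  inferInstanceAs (Finite {u : Fin (n + 1) → P // (coverInter u : Set P).Nonempty})

theorem IsFinite.cechCochain [Finite P] (hG : G.IsFinite) (n : ℕ) :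
    FiniteDimensional K (G.CechCochain n) := by
  have := fun U => hG.section U
  infer_instance

theorem IsFinite.cechH [Finite P] (hG : G.IsFinite) (n : ℕ) :
    FiniteDimensional K (G.CechH n) := by
  have := hG.cechCochain n
  infer_instance

theorem finrank_cechH_zero (G : Copresheaf.{u, v, w} K P) :
    Module.finrank K (G.CechH 0) = Module.finrank K (G.cechCocycle 0) := by
  refine LinearEquiv.finrank_eq (Submodule.quotEquivOfEqBot _ ?_)
  exact (Submodule.comap_bot _).trans (Submodule.ker_subtype _)

/-- Rank-nullity for the coboundary, arranged without subtraction. -/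
theorem finrank_cechH_succ [Finite P] (hG : G.IsFinite) (n : ℕ) :
    Module.finrank K (G.CechH (n + 1)) + Module.finrank K (G.CechCochain n) =
      Module.finrank K (G.cechCocycle (n + 1)) + Module.finrank K (G.cechCocycle n) := by
  have := hG.cechCochain n
  have := hG.cechCochain (n + 1)
  have hle : G.cechCoboundary (n + 1) ≤ G.cechCocycle (n + 1) := by
    rintro _ ⟨c, rfl⟩
    exact cechDelta_cechDelta n c
  have h1 := Submodule.finrank_quotient_add_finrank
    ((G.cechCoboundary (n + 1)).submoduleOf (G.cechCocycle (n + 1)))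
  have h2 := (Submodule.submoduleOfEquivOfLe hle).finrank_eq
  have h3 := LinearMap.finrank_range_add_finrank_ker (G.cechDelta n)
  have h4 : Module.finrank K (G.cechCoboundary (n + 1)) =
    Module.finrank K (LinearMap.range (G.cechDelta n)) := rfl
  have h5 : Module.finrank K (G.cechCocycle n) =
    Module.finrank K (LinearMap.ker (G.cechDelta n)) := rfl
  have h6 : Module.finrank K (G.CechH (n + 1)) = Module.finrank K (G.cechCocycle (n + 1) ⧸
    (G.cechCoboundary (n + 1)).submoduleOf (G.cechCocycle (n + 1))) := rfl
  omega

/-! ### Degree zero cohomology and global sections. -/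

/-- The vertex of the nerve of the covering given by an element. -/
def vertex (a : P) : CechSimplex P 0 := ⟨fun _ => a, a, mem_coverInter.2 fun _ => le_rfl⟩

theorem mem_vertex (a : P) : a ∈ coverInter (vertex a).1 :=
  mem_coverInter.2 fun _ => le_rfl

/-- The edge of the nerve of the covering given by two vertices with a common lower bound. -/
def edge {a : P} (u u' : CechSimplex P 0) (ha : a ∈ coverInter u.1) (ha' : a ∈ coverInter u'.1) :
    CechSimplex P 1 :=
  ⟨![u.1 0, u'.1 0], a, mem_coverInter.2 fun i => by
    fin_cases i
    exacts [mem_coverInter.1 ha 0, mem_coverInter.1 ha' 0]⟩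

/-- The cocycle condition on the edge joining `u` and `u'`, evaluated at `a`. -/
theorem eval_eq_of_mem_cechCocycle {c : G.CechCochain 0} (hc : c ∈ G.cechCocycle 0) {a : P}
    (u u' : CechSimplex P 0) (ha : a ∈ coverInter u.1) (ha' : a ∈ coverInter u'.1) :
    G.eval a ha (c u) = G.eval a ha' (c u') := by
  have hmem : a ∈ coverInter (edge u u' ha ha').1 := mem_coverInter.2 fun i => by
    fin_cases i
    exacts [mem_coverInter.1 ha 0, mem_coverInter.1 ha' 0]
  have h0 : CechSimplex.face 0 (edge u u' ha ha') = u' :=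
    Subtype.ext (funext fun i => by
      rw [Subsingleton.elim (α := Fin 1) i 0]; rfl)
  have h1 : CechSimplex.face 1 (edge u u' ha ha') = u :=
    Subtype.ext (funext fun i => by
      rw [Subsingleton.elim (α := Fin 1) i 0]; rfl)
  have h := eval_cechDelta c (edge u u' ha ha') a hmem
  have hz : G.eval a hmem (G.cechDelta 0 c (edge u u' ha ha')) = 0 := by
    rw [show G.cechDelta 0 c = 0 from hc]
    exact map_zero _
  rw [hz, Fin.sum_univ_two, eval_congr c h0 a _ ha', eval_congr c h1 a _ ha] at h
  simp only [Fin.val_zero, Fin.val_one, pow_zero, pow_one, one_smul, neg_smul] at h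
  exact (sub_eq_zero.1 ((sub_eq_add_neg _ _).trans h.symm)).symm

/-- The global section given by a Čech cocycle of degree zero. -/
def cechCocycleZeroToSection (G : Copresheaf.{u, v, w} K P) :
    G.cechCocycle 0 →ₗ[K] G.Section ⊤ where
  toFun c := mkSection (fun a _ => G.eval a (mem_vertex a) (c.1 (vertex a)))
    fun _ _ _ _ => (map_eval _ _ _).trans (eval_eq_of_mem_cechCocycle c.2 _ _ _ _)
  map_add' _ _ := rfl
  map_smul' _ _ := rfl

theorem cechDelta_restrict_top (s : G.Section ⊤) :
    G.cechDelta 0 (fun _ => G.restrict le_top s) = 0 := by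
  refine funext fun _ => section_ext fun a ha => ?_
  rw [eval_cechDelta, Fin.sum_univ_two, eval_restrict, eval_restrict]
  simp only [Fin.val_zero, Fin.val_one, pow_zero, pow_one, one_smul, neg_smul]
  exact (add_neg_cancel _).trans (map_zero _).symm

theorem cechCocycleZeroToSection_bijective (G : Copresheaf.{u, v, w} K P) :
    Function.Bijective G.cechCocycleZeroToSection := by
  constructor
  · intro c c' h
    refine Subtype.ext <| funext fun u => section_ext fun a ha => ?_
    rw [eval_eq_of_mem_cechCocycle c.2 u (vertex a) ha (mem_vertex a),
      eval_eq_of_mem_cechCocycle c'.2 u (vertex a) ha (mem_vertex a)]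
    exact congrArg (G.eval (U := ⊤) a LowerSet.mem_top) h
  · intro s
    exact ⟨⟨fun u => G.restrict le_top s, cechDelta_restrict_top s⟩, rfl⟩

theorem finrank_cechH_zero_eq_section (G : Copresheaf.{u, v, w} K P) :
    Module.finrank K (G.CechH 0) = Module.finrank K (G.Section ⊤) := by
  rw [finrank_cechH_zero,
    (LinearEquiv.ofBijective _ G.cechCocycleZeroToSection_bijective).finrank_eq]

/-- If the cohomology vanishes from degree `N` on, the Euler characteristic is a sum over the
degrees below `N`. -/
theorem cechEuler_eq_sum (G : Copresheaf.{u, v, w} K P) (N : ℕ)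
    (hN : ∀ k, N ≤ k → Module.finrank K (G.CechH k) = 0) :
    G.cechEuler = ∑ k ∈ Finset.range N, (-1 : ℤ) ^ k * (Module.finrank K (G.CechH k) : ℤ) := by
  refine finsum_eq_sum_of_support_subset _ fun k hk => ?_
  rw [Finset.coe_range, Set.mem_Iio]
  by_contra h
  exact hk (by simp only; rw [hN k (not_lt.1 h)]; simp)

/-! ### Short exact sequences of copresheaves -/

/-- A morphism of copresheaves. -/
structure Hom (G : Copresheaf.{u, v, w} K P) (H : Copresheaf.{u, v, z} K P) where
  /-- The linear map at an element. -/
  app : ∀ a, G.obj a →ₗ[K] H.obj a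
  naturality : ∀ {a b : P} (h : b ≤ a) (x : G.obj a), app b (G.map h x) = H.map h (app a x)

namespace Hom

variable {H : Copresheaf.{u, v, z} K P} (φ : G.Hom H)

/-- The map induced on sections. -/
def onSection (U : LowerSet P) : G.Section U →ₗ[K] H.Section U where
  toFun s := mkSection (fun a ha => φ.app a (G.eval a ha s)) fun a b ha hba => by
    rw [← φ.naturality, map_eval]
  map_add' s t := section_ext fun a ha => by simp [mkSection, eval]; rfl
  map_smul' s t := section_ext fun a ha => by simp [mkSection, eval]; rfl

@[simp]
theorem eval_onSection {U : LowerSet P} (s : G.Section U) (a : P) (ha : a ∈ U) :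
    H.eval a ha (φ.onSection U s) = φ.app a (G.eval a ha s) := rfl

/-- The map induced on Čech cochains. -/
def onCochain (n : ℕ) : G.CechCochain n →ₗ[K] H.CechCochain n :=
  LinearMap.pi fun u => φ.onSection _ ∘ₗ LinearMap.proj u

@[simp]
theorem onCochain_apply {n : ℕ} (c : G.CechCochain n) (u : CechSimplex P n) :
    φ.onCochain n c u = φ.onSection _ (c u) := rfl

theorem onCochain_cechDelta {n : ℕ} (c : G.CechCochain n) :
    φ.onCochain (n + 1) (G.cechDelta n c) = H.cechDelta n (φ.onCochain n c) := by
  refine funext fun u => section_ext fun a ha => ?_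
  simp [eval_cechDelta]

theorem onCochain_injective (hφ : ∀ a, Function.Injective (φ.app a)) (n : ℕ) :
    Function.Injective (φ.onCochain n) := by
  intro c c' h
  refine funext fun u => section_ext fun a ha => hφ a ?_
  rw [← eval_onSection, ← eval_onSection, ← onCochain_apply, ← onCochain_apply, h]

/-- The intersection of the members of a simplex has a greatest element `m`; lift the value there
and push it down. This is where bounded infima enter the index formula. -/
theorem onCochain_surjective (hP : HasBoundedInf P) (hφ : ∀ a, Function.Surjective (φ.app a))
    (n : ℕ) : Function.Surjective (φ.onCochain n) := by
  have hs : ∀ u : CechSimplex P n, Function.Surjective (φ.onSection (coverInter u.1)) := by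
    intro u s
    obtain ⟨m, hm⟩ := hP.coverInter_eq_Iic u.1 u.2
    have hmem : m ∈ coverInter u.1 := by rw [hm]; exact LowerSet.mem_Iic_iff.2 le_rfl
    have hle : ∀ a ∈ coverInter u.1, a ≤ m := fun a ha => by
      rw [hm] at ha; exact LowerSet.mem_Iic_iff.1 ha
    obtain ⟨x, hx⟩ := hφ m (H.eval m hmem s)
    refine ⟨mkSection (fun a ha => G.map (hle a ha) x) fun a b ha hba =>
      LinearMap.congr_fun (G.map_comp (hle a ha) hba) x, section_ext fun a ha => ?_⟩
    rw [eval_onSection, eval_mkSection, φ.naturality, hx, map_eval]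
  intro c
  choose f hf using hs
  exact ⟨fun u => f u (c u), funext fun u => hf u _⟩

/-- Pointwise preimages are unique since `ψ` is injective, hence automatically coherent. -/
theorem onCochain_exact {L : Copresheaf.{u, v, x} K P} (ψ : L.Hom G)
    (hψ : ∀ a, Function.Injective (ψ.app a))
    (hex : ∀ a, Function.Exact (ψ.app a) (φ.app a)) (n : ℕ) :
    Function.Exact (ψ.onCochain n) (φ.onCochain n) := by
  intro c
  constructor
  · intro hc
    have h : ∀ (u : CechSimplex P n) (a : P) (ha : a ∈ coverInter u.1),
        ∃ x, ψ.app a x = G.eval a ha (c u) := by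
      intro u a ha
      refine (hex a _).1 ?_
      rw [← eval_onSection, ← onCochain_apply, hc]
      rfl
    choose f hf using h
    have hcoh : ∀ (u : CechSimplex P n) (a b : P) (ha : a ∈ coverInter u.1) (hba : b ≤ a),
        L.map hba (f u a ha) = f u b ((coverInter u.1).lower hba ha) := by
      intro u a b ha hba
      refine hψ b ?_
      rw [ψ.naturality, hf, hf, map_eval]
    refine ⟨fun u => mkSection (f u) (hcoh u), ?_⟩
    refine funext fun u => section_ext fun a ha => ?_
    rw [onCochain_apply, eval_onSection, eval_mkSection, hf]
  · rintro ⟨c, rfl⟩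
    refine funext fun u => section_ext fun a ha => ?_
    rw [onCochain_apply, eval_onSection, onCochain_apply, eval_onSection, Pi.zero_apply, map_zero]
    exact (hex a _).2 ⟨_, rfl⟩

end Hom

end Copresheaf

/-- A dimension count for the connecting homomorphism of a short exact sequence of complexes, the
middle one of which is exact at the relevant place. -/
theorem finrank_add_finrank_ker_of_exact {K A₀ A₁ A₂ B₀ B₁ B₂ C₀ C₁ : Type*} [Field K]
    [AddCommGroup A₀] [AddCommGroup A₁] [AddCommGroup A₂] [AddCommGroup B₀] [AddCommGroup B₁]
    [AddCommGroup B₂] [AddCommGroup C₀] [AddCommGroup C₁] [Module K A₀] [Module K A₁] [Module K A₂]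
    [Module K B₀] [Module K B₁] [Module K B₂] [Module K C₀] [Module K C₁]
    [FiniteDimensional K B₀] {dA : A₁ →ₗ[K] A₂} {dB : B₀ →ₗ[K] B₁} {dB' : B₁ →ₗ[K] B₂}
    {dC : C₀ →ₗ[K] C₁} {f₀ : A₀ →ₗ[K] B₀} {f₁ : A₁ →ₗ[K] B₁} {f₂ : A₂ →ₗ[K] B₂}
    {g₀ : B₀ →ₗ[K] C₀} {g₁ : B₁ →ₗ[K] C₁} (hf₀ : Function.Injective f₀)
    (hf₁ : Function.Injective f₁) (hf₂ : Function.Injective f₂) (hg₀ : Function.Surjective g₀)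
    (h₀ : Function.Exact f₀ g₀) (h₁ : Function.Exact f₁ g₁) (hB : Function.Exact dB dB')
    (hf : ∀ x, f₂ (dA x) = dB' (f₁ x)) (hg : ∀ x, g₁ (dB x) = dC (g₀ x)) :
    Module.finrank K A₀ + Module.finrank K (LinearMap.ker dC) =
      Module.finrank K (LinearMap.ker dB) + Module.finrank K (LinearMap.ker dA) := by
  have : FiniteDimensional K C₀ := Module.Finite.of_surjective g₀ hg₀
  -- `W` is the domain of the zigzag of the connecting map: `dB` sends it onto `f₁ (ker dA)` with
  -- kernel `ker dB`, while surjectivity of `g₀` gives dim W = dim A₀ + dim ker dC.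
  set W := LinearMap.ker (dC ∘ₗ g₀)
  have hW := LinearMap.finrank_range_add_finrank_ker (dC ∘ₗ g₀)
  rw [LinearMap.range_comp, LinearMap.range_eq_top.2 hg₀, Submodule.map_top] at hW
  have hC := LinearMap.finrank_range_add_finrank_ker dC
  have hg' := LinearMap.finrank_range_add_finrank_ker g₀
  rw [LinearMap.range_eq_top.2 hg₀, finrank_top, h₀.linearMap_ker_eq,
    LinearMap.finrank_range_of_inj hf₀] at hg'
  have hd := LinearMap.finrank_range_add_finrank_ker (dB.domRestrict W)
  have hle : LinearMap.ker dB ≤ W := fun x hx => by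
    rw [LinearMap.mem_ker] at hx
    rw [LinearMap.mem_ker, LinearMap.comp_apply, ← hg, hx, map_zero]
  have hker : Module.finrank K (LinearMap.ker (dB.domRestrict W)) =
      Module.finrank K (LinearMap.ker dB) :=
    (Submodule.submoduleOfEquivOfLe hle).finrank_eq
  have hrange : LinearMap.range (dB.domRestrict W) = (LinearMap.ker dA).map f₁ := by
    ext y
    constructor
    · rintro ⟨x, rfl⟩
      have hx : g₁ (dB x.1) = 0 := (hg _).trans x.2
      obtain ⟨a, ha⟩ := (h₁ _).1 hx
      refine ⟨a, hf₂ ?_, ha⟩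
      rw [hf, ha, map_zero]
      exact hB.apply_apply_eq_zero _
    · rintro ⟨a, ha, rfl⟩
      have : dB' (f₁ a) = 0 := by rw [← hf, show dA a = 0 from ha, map_zero]
      obtain ⟨b, hb⟩ := (hB _).1 this
      refine ⟨⟨b, ?_⟩, hb⟩
      rw [LinearMap.mem_ker, LinearMap.comp_apply, ← hg, hb]
      exact h₁.apply_apply_eq_zero _
  rw [hrange, (Submodule.equivMapOfInjective f₁ hf₁ (LinearMap.ker dA)).symm.finrank_eq, hker] at hd
  have hWdef : Module.finrank K W = Module.finrank K (LinearMap.ker (dC ∘ₗ g₀)) := rfl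
  omega

namespace Copresheaf

variable {K : Type u} [Field K] {P : Type v} [PartialOrder P]

/-! ### The canonical resolution -/

/-- The copresheaf of all, not necessarily coherent, families. -/
def godement (G : Copresheaf.{u, v, w} K P) : Copresheaf.{u, v, max v w} K P where
  obj a := ∀ b : Set.Iic a, G.obj b
  map {a b} h := LinearMap.pi fun c : Set.Iic b =>
    LinearMap.proj (⟨c.1, c.2.trans h⟩ : Set.Iic a)
  map_refl _ := rfl
  map_comp _ _ := rfl

/-- The embedding of a copresheaf into the copresheaf of all families. -/
def toGodement (G : Copresheaf.{u, v, w} K P) : G.Hom G.godement where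
  app a := LinearMap.pi fun b : Set.Iic a => G.map b.2
  naturality h x := funext fun c =>
    LinearMap.congr_fun (G.map_comp h c.2) x

theorem toGodement_injective (G : Copresheaf.{u, v, w} K P) (a : P) :
    Function.Injective (G.toGodement.app a) := by
  intro x y h
  have h' : G.map (le_refl a) x = G.map (le_refl a) y := congrFun h ⟨a, le_rfl⟩
  rwa [G.map_refl] at h'

/-- The quotient of the copresheaf of all families. -/
def godementQuot (G : Copresheaf.{u, v, w} K P) : Copresheaf.{u, v, max v w} K P where
  obj a := G.godement.obj a ⧸ LinearMap.range (G.toGodement.app a)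
  map h := Submodule.mapQ _ _ (G.godement.map h) (by
    rintro _ ⟨x, rfl⟩
    exact ⟨G.map h x, G.toGodement.naturality h x⟩)
  map_refl _ := Submodule.linearMap_qext _ (by
    ext x
    rfl)
  map_comp h h' := Submodule.linearMap_qext _ rfl

/-- The projection of the copresheaf of all families onto the quotient. -/
def toGodementQuot (G : Copresheaf.{u, v, w} K P) : G.godement.Hom G.godementQuot where
  app _ := Submodule.mkQ _
  naturality _ _ := rfl

theorem toGodement_exact (G : Copresheaf.{u, v, w} K P) (a : P) :
    Function.Exact (G.toGodement.app a) (G.toGodementQuot.app a) :=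
  LinearMap.exact_map_mkQ_range _

theorem toGodementQuot_surjective (G : Copresheaf.{u, v, w} K P) (a : P) :
    Function.Surjective (G.toGodementQuot.app a) :=
  Submodule.mkQ_surjective _

variable {G : Copresheaf.{u, v, w} K P}

theorem IsFinite.godement [Finite P] (hG : G.IsFinite) : G.godement.IsFinite := fun a => by
  have := fun b => hG b
  exact inferInstanceAs (FiniteDimensional K (∀ b : Set.Iic a, G.obj b))

theorem IsFinite.godementQuot [Finite P] (hG : G.IsFinite) : G.godementQuot.IsFinite := fun a => by
  have := hG.godement a
  exact inferInstanceAs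
    (FiniteDimensional K (G.godement.obj a ⧸ LinearMap.range (G.toGodement.app a)))

/-- The component at `a` of a section of the copresheaf of all families. -/
def component (G : Copresheaf.{u, v, w} K P) {U : LowerSet P} (a : P) (ha : a ∈ U) :
    G.godement.Section U →ₗ[K] G.obj a :=
  (LinearMap.proj (⟨a, le_rfl⟩ : Set.Iic a) : G.godement.obj a →ₗ[K] G.obj a) ∘ₗ
    G.godement.eval a ha

/-- By coherence, a section is determined by its diagonal components, which are arbitrary. -/
theorem eval_godement {U : LowerSet P} (s : G.godement.Section U) {a : P} (ha : a ∈ U)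
    (b : Set.Iic a) : G.godement.eval a ha s b = G.component b.1 (U.lower b.2 ha) s :=
  congrFun (map_eval s ha b.2) ⟨b.1, le_rfl⟩

theorem godement_section_ext {U : LowerSet P} {s t : G.godement.Section U}
    (h : ∀ a (ha : a ∈ U), G.component a ha s = G.component a ha t) : s = t :=
  section_ext fun a ha => funext fun b => by rw [eval_godement, eval_godement, h]

/-- The section of the copresheaf of all families with given components. -/
def godementSection {U : LowerSet P} (s : ∀ a, a ∈ U → G.obj a) : G.godement.Section U :=
  mkSection (fun a ha (b : Set.Iic a) => s b.1 (U.lower b.2 ha)) fun _ _ _ _ => rfl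

@[simp]
theorem component_godementSection {U : LowerSet P} (s : ∀ a, a ∈ U → G.obj a) (a : P)
    (ha : a ∈ U) : G.component a ha (godementSection s) = s a ha := rfl

theorem component_cechDelta {n : ℕ} (c : G.godement.CechCochain n) (u : CechSimplex P (n + 1))
    (a : P) (ha : a ∈ coverInter u.1) :
    G.component a ha (G.godement.cechDelta n c u) =
      ∑ i : Fin (n + 2), (-1 : K) ^ (i : ℕ) • G.component a (face_mem ha i) (c (u.face i)) := by
  change LinearMap.proj (R := K) (φ := fun b : Set.Iic a => G.obj b) ⟨a, le_rfl⟩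
    (G.godement.eval a ha (G.godement.cechDelta n c u)) = _
  rw [eval_cechDelta]
  exact (map_sum (LinearMap.proj (R := K) (φ := fun b : Set.Iic a => G.obj b) ⟨a, le_rfl⟩) _ _)

theorem component_congr {n : ℕ} (c : G.godement.CechCochain n) {u u' : CechSimplex P n}
    (h : u = u') (a : P) (ha : a ∈ coverInter u.1) (ha' : a ∈ coverInter u'.1) :
    G.component a ha (c u) = G.component a ha' (c u') := by
  subst h; rfl

/-! ### Acyclicity of the canonical resolution. -/

/-- Prefix a sequence with a member of the intersection. -/
def _root_.CechSimplex.cons {n : ℕ} (u : CechSimplex P n) (a : P) (ha : a ∈ coverInter u.1) :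
    CechSimplex P (n + 1) :=
  ⟨Fin.cons a u.1, a, mem_coverInter.2 fun i => by
    induction i using Fin.cases with
    | zero => exact le_rfl
    | succ i => exact mem_coverInter.1 ha i⟩

theorem _root_.CechSimplex.mem_cons {n : ℕ} (u : CechSimplex P n) (a : P) (ha : a ∈ coverInter u.1) :
    a ∈ coverInter (u.cons a ha).1 := mem_coverInter.2 fun i => by
  induction i using Fin.cases with
  | zero => exact le_rfl
  | succ i => exact mem_coverInter.1 ha i

theorem _root_.CechSimplex.face_zero_cons {n : ℕ} (u : CechSimplex P n) (a : P)
    (ha : a ∈ coverInter u.1) : (u.cons a ha).face 0 = u :=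
  Subtype.ext (funext fun _ => rfl)

theorem _root_.CechSimplex.face_succ_cons {n : ℕ} (u : CechSimplex P (n + 1)) (a : P)
    (ha : a ∈ coverInter u.1) (i : Fin (n + 2)) :
    (u.cons a ha).face i.succ = (u.face i).cons a (face_mem ha i) :=
  Subtype.ext (funext fun j => by
    induction j using Fin.cases with
    | zero => rfl
    | succ j =>
      change (Fin.cons a u.1 : Fin (n + 3) → P) (i.succ.succAbove j.succ) = u.1 (i.succAbove j)
      rw [Fin.succ_succAbove_succ, Fin.cons_succ])

/-- The contracting homotopy takes as component at `a` of its value on `u` the component at `a` of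
the cochain on `(a, u)`. The prefix may depend on `a` because components need not be compatible. -/
theorem godement_exact (G : Copresheaf.{u, v, w} K P) (n : ℕ) :
    Function.Exact (G.godement.cechDelta n) (G.godement.cechDelta (n + 1)) := by
  intro c
  constructor
  · intro hc
    refine ⟨fun u => godementSection fun a ha => G.component a (u.mem_cons a ha) (c (u.cons a ha)),
      funext fun u => godement_section_ext fun a ha => ?_⟩
    have h := component_cechDelta c (u.cons a ha) a (u.mem_cons a ha)
    rw [hc, Pi.zero_apply, map_zero, Fin.sum_univ_succ,
      component_congr c (u.face_zero_cons a ha) a _ ha] at h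
    simp only [Fin.val_zero, pow_zero, one_smul, Fin.val_succ, pow_succ, mul_neg, mul_one,
      neg_smul, Finset.sum_neg_distrib] at h
    rw [component_cechDelta, sub_eq_zero.1 ((sub_eq_add_neg _ _).trans h.symm)]
    refine Finset.sum_congr rfl fun i _ => ?_
    rw [component_godementSection, component_congr c (u.face_succ_cons a ha i) a]
  · rintro ⟨c, rfl⟩
    exact cechDelta_cechDelta n c

theorem finrank_cechH_zero_godement [Fintype P] (hG : G.IsFinite) :
    Module.finrank K (G.godement.CechH 0) = ∑ a, Module.finrank K (G.obj a) := by
  have := fun b => hG b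
  rw [finrank_cechH_zero_eq_section, ← Module.finrank_pi_fintype K]
  refine LinearEquiv.finrank_eq (LinearEquiv.ofBijective
    (LinearMap.pi fun a => G.component (U := ⊤) a LowerSet.mem_top) ⟨fun s t h => ?_, fun x => ?_⟩)
  · exact godement_section_ext fun a _ => congrFun h a
  · exact ⟨godementSection fun a _ => x a, rfl⟩

/-- The long exact sequence with acyclic middle term, as a count of dimensions. -/
theorem finrank_cechH_succ_succ [Finite P] (hP : HasBoundedInf P) (hG : G.IsFinite) (n : ℕ) :
    Module.finrank K (G.CechH (n + 2)) = Module.finrank K (G.godementQuot.CechH (n + 1)) ∧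
    Module.finrank K (G.CechH 1) + Module.finrank K (G.godement.CechH 0) =
      Module.finrank K (G.CechH 0) + Module.finrank K (G.godementQuot.CechH 0) := by
  have hJ := hG.godement
  have hQ := hG.godementQuot
  have key : ∀ n, Module.finrank K (G.CechCochain n) +
      Module.finrank K (G.godementQuot.cechCocycle n) =
      Module.finrank K (G.godement.cechCocycle n) + Module.finrank K (G.cechCocycle (n + 1)) := by
    intro n
    have := hJ.cechCochain n
    exact finrank_add_finrank_ker_of_exact
      (G.toGodement.onCochain_injective G.toGodement_injective n)
      (G.toGodement.onCochain_injective G.toGodement_injective (n + 1))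
      (G.toGodement.onCochain_injective G.toGodement_injective (n + 2))
      (G.toGodementQuot.onCochain_surjective hP G.toGodementQuot_surjective n)
      (G.toGodementQuot.onCochain_exact G.toGodement G.toGodement_injective G.toGodement_exact n)
      (G.toGodementQuot.onCochain_exact G.toGodement G.toGodement_injective G.toGodement_exact
        (n + 1))
      (G.godement_exact n)
      (fun c => G.toGodement.onCochain_cechDelta c) (fun c => G.toGodementQuot.onCochain_cechDelta c)
  have dim : ∀ n, Module.finrank K (G.godement.CechCochain n) =
      Module.finrank K (G.CechCochain n) + Module.finrank K (G.godementQuot.CechCochain n) := by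
    intro n
    have := hJ.cechCochain n
    have h := LinearMap.finrank_range_add_finrank_ker (G.toGodementQuot.onCochain n)
    rw [LinearMap.range_eq_top.2
      (G.toGodementQuot.onCochain_surjective hP G.toGodementQuot_surjective n), finrank_top,
      (G.toGodementQuot.onCochain_exact G.toGodement G.toGodement_injective
        G.toGodement_exact n).linearMap_ker_eq, LinearMap.finrank_range_of_inj
      (G.toGodement.onCochain_injective G.toGodement_injective n)] at h
    omega
  have exact : ∀ n, Module.finrank K (G.godement.CechCochain n) =
      Module.finrank K (G.godement.cechCocycle (n + 1)) +
        Module.finrank K (G.godement.cechCocycle n) := by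
    intro n
    have := hJ.cechCochain n
    have h := LinearMap.finrank_range_add_finrank_ker (G.godement.cechDelta n)
    rw [← (G.godement_exact n).linearMap_ker_eq] at h
    exact h.symm
  have hA := finrank_cechH_succ hG
  have hC := finrank_cechH_succ hQ
  have hA0 := finrank_cechH_zero G
  have hB0 := finrank_cechH_zero G.godement
  have hC0 := finrank_cechH_zero G.godementQuot
  constructor
  · have h1 : Module.finrank K (G.CechH (n + 2)) + Module.finrank K (G.CechCochain (n + 1)) =
      Module.finrank K (G.cechCocycle (n + 2)) + Module.finrank K (G.cechCocycle (n + 1)) :=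
      hA (n + 1)
    have h2 : Module.finrank K (G.CechCochain (n + 1)) +
      Module.finrank K (G.godementQuot.cechCocycle (n + 1)) =
      Module.finrank K (G.godement.cechCocycle (n + 1)) +
        Module.finrank K (G.cechCocycle (n + 2)) := key (n + 1)
    have := hC n
    have := key n
    have := dim n
    have := exact n
    omega
  · have h1 : Module.finrank K (G.CechH 1) + Module.finrank K (G.CechCochain 0) =
      Module.finrank K (G.cechCocycle 1) + Module.finrank K (G.cechCocycle 0) := hA 0
    have h2 : Module.finrank K (G.CechCochain 0) +
      Module.finrank K (G.godementQuot.cechCocycle 0) =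
      Module.finrank K (G.godement.cechCocycle 0) + Module.finrank K (G.cechCocycle 1) := key 0
    omega

end Copresheaf

namespace Copresheaf

variable {K : Type u} [Field K] {P : Type v} [PartialOrder P] {G : Copresheaf.{u, v, w} K P}

/-! ### The index formula -/

/-- The Čech cohomology of `G` is finite, and its Euler characteristic is the total mass of a
function `f` whose sums over the principal lower sets are the dimensions of the values of `G`. -/
structure HasIndex [Fintype P] (G : Copresheaf.{u, v, w} K P) (f : P → ℤ) : Prop where
  finrank_eq : ∀ b, (Module.finrank K (G.obj b) : ℤ) = zetaSum f b
  finite : G.HasFiniteCechCohomology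
  cechEuler_eq : G.cechEuler = ∑ a, f a

theorem finrank_godement [Fintype P] (hG : G.IsFinite) (b : P) :
    (Module.finrank K (G.godement.obj b) : ℤ) =
      zetaSum (fun a => (Module.finrank K (G.obj a) : ℤ)) b := by
  classical
  have := fun b => hG b
  change (Module.finrank K (∀ c : Set.Iic b, G.obj c) : ℤ) = _
  rw [Module.finrank_pi_fintype K, zetaSum, ← Finset.sum_filter, Nat.cast_sum]
  exact (Finset.sum_subtype _ (by simp) fun a => (Module.finrank K (G.obj a) : ℤ)).symm

theorem finrank_godementQuot [Finite P] (hG : G.IsFinite) (b : P) :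
    Module.finrank K (G.godementQuot.obj b) + Module.finrank K (G.obj b) =
      Module.finrank K (G.godement.obj b) := by
  have := hG.godement b
  rw [← LinearMap.finrank_range_of_inj (G.toGodement_injective b)]
  exact Submodule.finrank_quotient_add_finrank _

/-- Dimension shifting: both dim G_b = dim J_b − dim Q_b and χ(G) = dim H^0(J) − χ(Q) correspond to
replacing `f` by dim G − f. -/
theorem HasIndex.of_godementQuot [Fintype P] (hP : HasBoundedInf P) (hG : G.IsFinite) {f : P → ℤ}
    (h : G.godementQuot.HasIndex f) :
    G.HasIndex fun a => (Module.finrank K (G.obj a) : ℤ) - f a := by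
  have hQ := hG.godementQuot
  obtain ⟨d, hd⟩ := h.finite.2
  have hQ0 : ∀ k, d + 1 ≤ k → Module.finrank K (G.godementQuot.CechH k) = 0 := fun k hk => by
    have := hd k hk
    exact Module.finrank_zero_of_subsingleton
  have hG0 : ∀ k, d + 2 ≤ k → Module.finrank K (G.CechH k) = 0 := fun k hk => by
    obtain ⟨k, rfl⟩ : ∃ m, k = m + 2 := ⟨k - 2, by omega⟩
    rw [(finrank_cechH_succ_succ hP hG k).1, hQ0 _ (by omega)]
  refine ⟨fun b => ?_, ⟨hG.cechH, d + 1, fun k hk => ?_⟩, ?_⟩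
  · have h1 := finrank_godementQuot hG b
    have h2 := finrank_godement hG b
    have h3 := h.finrank_eq b
    have h4 : zetaSum (fun a => (Module.finrank K (G.obj a) : ℤ) - f a) b =
        zetaSum (fun a => (Module.finrank K (G.obj a) : ℤ)) b - zetaSum f b := by
      simp only [zetaSum, ← Finset.sum_sub_distrib]
      exact Finset.sum_congr rfl fun a _ => by split_ifs <;> simp
    omega
  · have := hG.cechH k
    exact Module.finrank_zero_iff.1 (hG0 k (by omega))
  -- Degrees 0 and 1 of `G` and degree 0 of the quotient are split off; the remaining degrees match
  -- with opposite signs.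
  · rw [Finset.sum_sub_distrib, ← h.cechEuler_eq, cechEuler_eq_sum _ (d + 2) hG0,
      cechEuler_eq_sum _ (d + 1) hQ0, Finset.sum_range_succ', Finset.sum_range_succ',
      Finset.sum_range_succ']
    have h1 := (finrank_cechH_succ_succ hP hG 0).2
    have h2 := finrank_cechH_zero_godement hG
    have h3 : ∀ k ∈ Finset.range d,
        (-1 : ℤ) ^ (k + 1 + 1) * (Module.finrank K (G.CechH (k + 1 + 1)) : ℤ) =
        -((-1 : ℤ) ^ (k + 1) * (Module.finrank K (G.godementQuot.CechH (k + 1)) : ℤ)) := by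
      intro k _
      have := (finrank_cechH_succ_succ hP hG k).1
      rw [this, pow_succ]
      ring
    rw [Finset.sum_congr rfl h3, Finset.sum_neg_distrib, ← Nat.cast_sum, ← h2]
    simp only [zero_add, pow_zero, pow_one, one_mul]
    have h1' : (Module.finrank K (G.CechH 1) : ℤ) + Module.finrank K (G.godement.CechH 0) =
      Module.finrank K (G.CechH 0) + Module.finrank K (G.godementQuot.CechH 0) := by
      exact_mod_cast h1
    linarith

theorem HasIndex.of_subsingleton [Fintype P] (hG : ∀ a, Subsingleton (G.obj a)) :
    G.HasIndex 0 := by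
  have hs : ∀ U, Subsingleton (G.Section U) := fun U => ⟨fun s t =>
    section_ext fun a _ => (hG a).elim _ _⟩
  have hc : ∀ n, Subsingleton (G.CechH n) := fun n => inferInstance
  have h0 : ∀ n, Module.finrank K (G.CechH n) = 0 := fun n => Module.finrank_zero_of_subsingleton
  refine ⟨fun b => ?_, ⟨fun k => inferInstance, 0, fun k _ => hc k⟩, ?_⟩
  · rw [Module.finrank_zero_of_subsingleton]
    simp [zetaSum]
  · rw [cechEuler_eq_sum G 0 fun k _ => h0 k]
    simp

/-- Only the factor at `a` survives in the product, and the embedding is the identity on it. -/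
theorem godementQuot_subsingleton {a : P} (h : ∀ b < a, Subsingleton (G.obj b)) :
    Subsingleton (G.godementQuot.obj a) := by
  refine Submodule.Quotient.subsingleton_iff.2 (LinearMap.range_eq_top.2 fun s => ?_)
  refine ⟨s ⟨a, le_rfl⟩, funext fun b => ?_⟩
  rcases b with ⟨b, hb : b ≤ a⟩
  rcases hb.eq_or_lt with rfl | hlt
  · exact LinearMap.congr_fun (G.map_refl b) _
  · exact (h b hlt).elim _ _

/-- A copresheaf of finite dimensional spaces has an index if it vanishes on a lower set. The
induction is over the complement of the lower set. -/
theorem exists_hasIndex_of_subsingleton [Fintype P] (hP : HasBoundedInf P) (n : ℕ) :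
    ∀ (G : Copresheaf.{u, v, max v w} K P), G.IsFinite → ∀ S : Finset P, S.card = n →
      (IsUpperSet (S : Set P)) → (∀ a ∉ S, Subsingleton (G.obj a)) → ∃ f, G.HasIndex f := by
  classical
  induction n with
  | zero =>
    intro G _ S hS _ hG
    rw [Finset.card_eq_zero] at hS
    subst hS
    exact ⟨0, HasIndex.of_subsingleton fun a => hG a (by simp)⟩
  | succ n ih =>
    intro G hGf S hS hup hG
    -- `G` vanishes strictly below the minimal `m`, so the quotient vanishes at `m` too and is
    -- supported on a smaller upper set.
    obtain ⟨m, hm⟩ := S.exists_minimal (Finset.card_pos.1 (by omega))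
    have hlt : ∀ b < m, b ∉ S := fun b hb hbS => hb.not_ge (hm.le_of_le hbS hb.le)
    obtain ⟨f, hf⟩ := ih G.godementQuot hGf.godementQuot (S.erase m)
      (by rw [Finset.card_erase_of_mem hm.prop, hS]; rfl)
      (by
        intro a b hab ha
        simp only [Finset.coe_erase, Set.mem_sdiff, Finset.mem_coe, Set.mem_singleton_iff] at ha ⊢
        refine ⟨hup hab ha.1, ?_⟩
        rintro rfl
        exact hlt a (lt_of_le_of_ne hab ha.2) ha.1)
      (by
        intro a ha
        refine godementQuot_subsingleton fun b hb => hG b fun hbS => ha ?_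
        refine Finset.mem_erase.2 ⟨?_, hup hb.le hbS⟩
        rintro rfl
        exact hlt b hb hbS)
    exact ⟨_, HasIndex.of_godementQuot hP hGf hf⟩

/-- One quotient is taken before the induction, so that the values lie in a universe stable under
further quotients. -/
theorem exists_hasIndex [Fintype P] (hP : HasBoundedInf P) (hG : G.IsFinite) :
    ∃ f, G.HasIndex f := by
  obtain ⟨f, hf⟩ := exists_hasIndex_of_subsingleton.{u, v, w} hP _ G.godementQuot hG.godementQuot
    Finset.univ rfl (by simp [isUpperSet_univ]) (by simp)
  exact ⟨_, HasIndex.of_godementQuot hP hG hf⟩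

/-- The index formula. -/
theorem HasIndex.cechEuler_eq_sum_mu [Fintype P] [LocallyFiniteOrder P] [DecidableEq P]
    {f : P → ℤ} (h : G.HasIndex f) :
    G.cechEuler = ∑ a : P, ∑ b : P, IncidenceAlgebra.mu ℤ b a * (Module.finrank K (G.obj b) : ℤ) := by
  rw [h.cechEuler_eq, ← sum_mu_mul_zetaSum]
  simp only [h.finrank_eq]

theorem const_isFinite : (Copresheaf.const K P).IsFinite := fun _ =>
  inferInstanceAs (FiniteDimensional K K)

/-! ### Global sections of copresheaves with extendable sections -/

/-- Coherent families on the elements strictly below `a` extend to `a`. -/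
def IsExtendable (G : Copresheaf.{u, v, w} K P) : Prop :=
  ∀ a, ∀ s : G.Section (LowerSet.Iio a), ∃ x : G.obj a, ∀ b (hb : b < a),
    G.map hb.le x = G.eval b hb s

/-- The elements of `G_a` which vanish strictly below `a`. -/
def vanishing (G : Copresheaf.{u, v, w} K P) (a : P) : Submodule K (G.obj a) :=
  ⨅ b : Set.Iio a, LinearMap.ker (G.map b.2.le)

theorem mem_vanishing {a : P} {x : G.obj a} :
    x ∈ G.vanishing a ↔ ∀ b (hb : b < a), G.map hb.le x = 0 := by
  simp [vanishing]

open Classical in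
/-- Adding a minimal element to a lower set adds the dimension of the vanishing subspace to the
dimension of the space of sections. -/
theorem IsExtendable.finrank_section_insert [Finite P] (hG : G.IsFinite) (he : G.IsExtendable)
    {U V : LowerSet P} {a : P} (hUV : U ≤ V) (haU : a ∉ U) (hV : ∀ b, b ∈ V ↔ b = a ∨ b ∈ U) :
    Module.finrank K (G.Section V) =
      Module.finrank K (G.Section U) + Module.finrank K (G.vanishing a) := by
  have := hG.section V
  have haV : a ∈ V := (hV a).2 (Or.inl rfl)
  have hlt : ∀ b, b < a → b ∈ U := fun b hb =>
    ((hV b).1 (V.lower hb.le haV)).resolve_left hb.ne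
  have hne : ∀ b ∈ U, ¬ a ≤ b := fun b hb hab => haU (U.lower hab hb)
  have hsurj : Function.Surjective (G.restrict hUV) := by
    intro s
    obtain ⟨x, hx⟩ := he a (G.restrict (fun b hb => hlt b hb) s)
    refine ⟨mkSection (fun b hb => if h : a = b then h ▸ x else
      G.eval b (((hV b).1 hb).resolve_left fun h' => h h'.symm) s) ?_, ?_⟩
    · intro b c hb hcb
      by_cases hab : a = b
      · subst hab
        rw [dif_pos rfl]
        rcases hcb.eq_or_lt with rfl | hca
        · rw [dif_pos rfl]
          exact LinearMap.congr_fun (G.map_refl c) x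
        · rw [dif_neg hca.ne']
          exact hx c hca
      · have hbU := ((hV b).1 hb).resolve_left fun h' => hab h'.symm
        rw [dif_neg hab, dif_neg (by rintro rfl; exact hne b hbU hcb), map_eval]
    · refine section_ext fun b hb => ?_
      rw [eval_restrict, eval_mkSection, dif_neg (by rintro rfl; exact haU hb)]
  have hker : Module.finrank K (LinearMap.ker (G.restrict hUV)) =
      Module.finrank K (G.vanishing a) := by
    have hz : ∀ s ∈ LinearMap.ker (G.restrict hUV), ∀ b (hb : b ∈ U),
        G.eval b (hUV hb) s = 0 := by
      intro s hs b hb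
      rw [← eval_restrict hUV s hb, LinearMap.mem_ker.1 hs, map_zero]
    have hmem : ∀ s : LinearMap.ker (G.restrict hUV), G.eval a haV s.1 ∈ G.vanishing a := by
      intro s
      refine mem_vanishing.2 fun b hb => ?_
      rw [map_eval, hz _ s.2 b (hlt b hb)]
    refine LinearEquiv.finrank_eq (LinearEquiv.ofBijective
      (((G.eval a haV).domRestrict _).codRestrict (G.vanishing a) hmem) ⟨?_, ?_⟩)
    · intro s t hst
      refine Subtype.ext (section_ext fun b hb => ?_)
      rcases (hV b).1 hb with rfl | hbU
      · exact congrArg Subtype.val hst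
      · rw [hz _ s.2 b hbU, hz _ t.2 b hbU]
    · intro x
      refine ⟨⟨mkSection (fun b _ => if h : a = b then h ▸ x.1 else 0) ?_, ?_⟩, ?_⟩
      · intro b c hb hcb
        by_cases hab : a = b
        · subst hab
          rw [dif_pos rfl]
          rcases hcb.eq_or_lt with rfl | hca
          · rw [dif_pos rfl]
            exact LinearMap.congr_fun (G.map_refl c) x.1
          · rw [dif_neg hca.ne', mem_vanishing.1 x.2 c hca]
        · have hbU := ((hV b).1 hb).resolve_left fun h' => hab h'.symm
          rw [dif_neg hab, dif_neg (by rintro rfl; exact hne b hbU hcb), map_zero]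
      · refine LinearMap.mem_ker.2 (section_ext fun b hb => ?_)
        rw [eval_restrict, eval_mkSection, dif_neg (by rintro rfl; exact haU hb), map_zero]
      · refine Subtype.ext ?_
        exact dif_pos rfl
  have h := LinearMap.finrank_range_add_finrank_ker (G.restrict hUV)
  rw [LinearMap.range_eq_top.2 hsurj, finrank_top, hker] at h
  exact h.symm

/-- Peel off maximal elements one by one. -/
theorem IsExtendable.finrank_section [Finite P] (hG : G.IsFinite) (he : G.IsExtendable)
    (S : Finset P) : ∀ U : LowerSet P, (∀ a, a ∈ U ↔ a ∈ S) →
    Module.finrank K (G.Section U) = ∑ a ∈ S, Module.finrank K (G.vanishing a) := by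
  classical
  induction hn : S.card generalizing S with
  | zero =>
    intro U hU
    rw [Finset.card_eq_zero] at hn
    subst hn
    have : Subsingleton (G.Section U) := ⟨fun s t =>
      section_ext fun a ha => absurd ((hU a).1 ha) (by simp)⟩
    rw [Module.finrank_zero_of_subsingleton, Finset.sum_empty]
  | succ n ih =>
    intro V hV
    obtain ⟨m, hm⟩ := S.exists_maximal (Finset.card_pos.1 (by omega))
    let U : LowerSet P := ⟨{a | a ∈ S.erase m}, by
      intro a b hba ha
      simp only [Finset.mem_erase, Set.mem_ofPred_eq] at ha ⊢
      refine ⟨?_, (hV b).1 (V.lower hba ((hV a).2 ha.2))⟩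
      rintro rfl
      exact ha.1 (hm.eq_of_ge ha.2 hba)⟩
    have hU : ∀ a, a ∈ U ↔ a ∈ S.erase m := fun a => Iff.rfl
    rw [he.finrank_section_insert hG (U := U) (V := V) (a := m)
      (fun a ha => (hV a).2 (Finset.mem_of_mem_erase ha)) (fun h => by simp [hU] at h)
      (fun b => by
        rw [hU, hV, Finset.mem_erase]
        by_cases hb : b = m
        · simp [hb, hm.prop]
        · simp [hb]),
      ih (S.erase m) (by rw [Finset.card_erase_of_mem hm.prop, hn]; rfl) U hU,
      Finset.sum_erase_add _ _ hm.prop]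

theorem finrank_section_Iic (G : Copresheaf.{u, v, w} K P) (a : P) :
    Module.finrank K (G.Section (LowerSet.Iic a)) = Module.finrank K (G.obj a) := by
  refine LinearEquiv.finrank_eq (LinearEquiv.ofBijective
    (G.eval a (LowerSet.mem_Iic_iff.2 le_rfl)) ⟨fun s t h => section_ext fun b hb => ?_,
      fun x => ?_⟩)
  · have hba := LowerSet.mem_Iic_iff.1 hb
    rw [← map_eval s (LowerSet.mem_Iic_iff.2 le_rfl) hba, h, map_eval]
  · exact ⟨mkSection (fun b hb => G.map (LowerSet.mem_Iic_iff.1 hb) x) fun b c hb hcb =>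
      LinearMap.congr_fun (G.map_comp (LowerSet.mem_Iic_iff.1 hb) hcb) x,
      LinearMap.congr_fun (G.map_refl a) x⟩

/-- `finrank_section` over the whole poset gives the total of dim `vanishing`, and over `Iic b` its
sum below `b`, which is dim G_b; then Möbius inversion. -/
theorem IsExtendable.finrank_cechH_zero [Fintype P] [LocallyFiniteOrder P] [DecidableEq P]
    (hG : G.IsFinite) (he : G.IsExtendable) :
    (Module.finrank K (G.CechH 0) : ℤ) =
      ∑ a : P, ∑ b : P, IncidenceAlgebra.mu ℤ b a * (Module.finrank K (G.obj b) : ℤ) := by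
  classical
  rw [finrank_cechH_zero_eq_section, he.finrank_section hG Finset.univ ⊤ (by simp),
    Nat.cast_sum, ← sum_mu_mul_zetaSum]
  refine Finset.sum_congr rfl fun a _ => Finset.sum_congr rfl fun b _ => ?_
  rw [← finrank_section_Iic G b, he.finrank_section hG (Finset.univ.filter (· ≤ b)) _ (by simp),
    zetaSum, ← Finset.sum_filter, Nat.cast_sum]

end Copresheaf

theorem Copresheaf.finrank_const (K : Type u) [Field K] (P : Type v) [PartialOrder P] (b : P) :
    Module.finrank K ((Copresheaf.const K P).obj b) = 1 :=
  Module.finrank_self K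

/-! ### The free copresheaf -/

section Free

variable (K : Type w) [Field K] {I : Type u} {E : I → Type v}

/-- Extend a family on `β` to a family on `α`, using the values of `e` outside `β`. -/
def padOutcome [DecidableEq I] (e : ∀ i, E i) (β α : Finset I) (y : Outcome E β) : Outcome E α :=
  fun i => if h : i.1 ∈ β then y ⟨i.1, h⟩ else e i

theorem padOutcome_restrict [DecidableEq I] (e : ∀ i, E i) (β γ : Finset I) (y : Outcome E β) :
    padOutcome e (β ∩ γ) γ (Finset.restrict₂ (π := E) Finset.inter_subset_left y) =
      padOutcome e β γ y := by
  funext i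
  simp [padOutcome, Finset.restrict₂]

theorem padOutcome_self [DecidableEq I] (e : ∀ i, E i) (β : Finset I) (y : Outcome E β) :
    padOutcome e β β y = y := by
  funext i
  simp [padOutcome]

/-- The marginal on `β` of an element of the free vector space on `E_α`. -/
abbrev marginal {α β : Finset I} (h : β ⊆ α) : (Outcome E α →₀ K) →ₗ[K] (Outcome E β →₀ K) :=
  Finsupp.lmapDomain K K (Finset.restrict₂ (π := E) h)

/-- The linear map induced by extending families. -/
def padLinear [DecidableEq I] (e : ∀ i, E i) (β α : Finset I) :
    (Outcome E β →₀ K) →ₗ[K] (Outcome E α →₀ K) :=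
  Finsupp.lmapDomain K K (padOutcome e β α)

variable {K}

theorem marginal_marginal {α β γ : Finset I} (h : β ⊆ α) (h' : γ ⊆ β) (x : Outcome E α →₀ K) :
    marginal K h' (marginal K h x) = marginal K (h'.trans h) x := by
  rw [← LinearMap.comp_apply, marginal, marginal, ← Finsupp.lmapDomain_comp]
  rfl

/-- Padding uses the fixed values `e` outside `β`, so a padded vector is seen on `γ` only through
its marginal on `β ∩ γ`. -/
theorem marginal_padLinear [DecidableEq I] (e : ∀ i, E i) {α γ : Finset I} (β : Finset I)
    (h : γ ⊆ α) (x : Outcome E β →₀ K) :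
    marginal K h (padLinear K e β α x) =
      padLinear K e (β ∩ γ) γ (marginal K Finset.inter_subset_left x) := by
  rw [← LinearMap.comp_apply, ← LinearMap.comp_apply, marginal, marginal, padLinear, padLinear,
    ← Finsupp.lmapDomain_comp, ← Finsupp.lmapDomain_comp]
  congr 2
  exact funext fun y => (padOutcome_restrict e β γ y).symm

theorem marginal_padLinear_self [DecidableEq I] (e : ∀ i, E i) {α β : Finset I}
    (h : β ⊆ α) (x : Outcome E β →₀ K) : marginal K h (padLinear K e β α x) = x := by
  rw [← LinearMap.comp_apply, marginal, padLinear, ← Finsupp.lmapDomain_comp,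
    show Finset.restrict₂ (π := E) h ∘ padOutcome e β α = id from
      funext fun y => padOutcome_self e β y, Finsupp.lmapDomain_id]
  rfl

theorem eq_zero_of_coordSum_eq_zero {X : Type z} [Subsingleton X] {x : X →₀ K}
    (h : coordSum K X x = 0) : x = 0 := by
  ext a
  have hx : x = Finsupp.single a (x a) := by
    ext b
    rw [Subsingleton.elim b a, Finsupp.single_eq_same]
  rw [hx] at h
  simpa [coordSum] using h

theorem finrank_ker_coordSum {X : Type z} [Finite X] [Nonempty X] :
    Module.finrank K (LinearMap.ker (coordSum K X)) + 1 = Nat.card X := by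
  have := Fintype.ofFinite X
  have h := LinearMap.finrank_range_add_finrank_ker (coordSum K X)
  have hs : Function.Surjective (coordSum K X) := fun c =>
    ⟨Finsupp.single (Classical.arbitrary X) c, by simp [coordSum]⟩
  rw [LinearMap.range_eq_top.2 hs, finrank_top, Module.finrank_self, Module.finrank_finsupp_self,
    ← Nat.card_eq_fintype_card] at h
  omega

variable (K) (E) (𝒜 : Finset (Finset I))

theorem freeCopresheaf_isFinite [∀ i, Finite (E i)] : (freeCopresheaf K 𝒜 E).IsFinite := fun α =>
  inferInstanceAs (FiniteDimensional K (Outcome E α.1 →₀ K))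

theorem restrictedFreeCopresheaf_isFinite [∀ i, Finite (E i)] :
    (restrictedFreeCopresheaf K 𝒜 E).IsFinite := fun α =>
  inferInstanceAs (FiniteDimensional K (LinearMap.ker (coordSum K (Outcome E α.1))))

theorem finrank_freeCopresheaf [∀ i, Finite (E i)] (α : 𝒜) :
    Module.finrank K ((freeCopresheaf K 𝒜 E).obj α) = Nat.card (Outcome E α.1) := by
  have := Fintype.ofFinite (Outcome E α.1)
  rw [Nat.card_eq_fintype_card]
  exact Module.finrank_finsupp_self K

/-- Coherent families of vectors with coordinate sum zero extend. -/
theorem restrictedFreeCopresheaf_isExtendable [DecidableEq I] [∀ i, Nonempty (E i)]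
    (h𝒜 : WeakIntersectionProperty 𝒜) : (restrictedFreeCopresheaf K 𝒜 E).IsExtendable := by
  intro α s
  let e : ∀ i, E i := fun i => Classical.arbitrary _
  let y : ∀ β : 𝒜, β < α → (Outcome E β.1 →₀ K) := fun β hβ =>
    ((restrictedFreeCopresheaf K 𝒜 E).eval β hβ s).1
  have hy0 : ∀ β hβ, coordSum K _ (y β hβ) = 0 := fun β hβ =>
    ((restrictedFreeCopresheaf K 𝒜 E).eval β hβ s).2
  have hy : ∀ (β γ : 𝒜) (hβ : β < α) (hγβ : γ ≤ β),
      marginal K hγβ (y β hβ) = y γ (hγβ.trans_lt hβ) := fun β γ hβ hγβ =>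
    congrArg Subtype.val (Copresheaf.map_eval s (a := β) (b := γ) hβ hγβ)
  have main : ∀ T : Finset 𝒜, ∃ x : Outcome E α.1 →₀ K, coordSum K _ x = 0 ∧
      ∀ β ∈ T, ∀ hβ : β < α, marginal K hβ.le x = y β hβ := by
    intro T
    induction T using Finset.induction_on with
    | empty => exact ⟨0, map_zero _, by simp⟩
    | insert β T _ ih =>
      obtain ⟨x, hx0, hx⟩ := ih
      by_cases hβ : β < α
      swap
      · refine ⟨x, hx0, fun γ hγ hγα => hx γ ?_ hγα⟩
        exact (Finset.mem_insert.1 hγ).resolve_left (by rintro rfl; exact hβ hγα)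
      have hd0 : coordSum K _ (y β hβ - marginal K hβ.le x) = 0 := by
        rw [map_sub, hy0, marginal, coordSum_lmapDomain, hx0, sub_zero]
      -- Correct `x` by its padded error on `β`. On each `γ` already treated the error has zero
      -- marginal on `β ∩ γ`, so nothing is spoiled.
      refine ⟨x + padLinear K e β.1 α.1 (y β hβ - marginal K hβ.le x), ?_, ?_⟩
      · rw [map_add, padLinear, coordSum_lmapDomain, hx0, hd0, add_zero]
      · intro γ hγ hγα
        rw [map_add]
        rcases Finset.mem_insert.1 hγ with rfl | hγT
        · rw [marginal_padLinear_self, add_sub_cancel]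
        · have hzero : marginal K (Finset.inter_subset_left : β.1 ∩ γ.1 ⊆ β.1)
              (y β hβ - marginal K hβ.le x) = 0 := by
            by_cases hne : (β.1 ∩ γ.1).Nonempty
            · let δ : 𝒜 := ⟨β.1 ∩ γ.1, h𝒜 _ β.2 _ γ.2 hne⟩
              have hδβ : δ ≤ β := Finset.inter_subset_left
              have hδγ : δ ≤ γ := Finset.inter_subset_right
              have h1 : marginal K hδγ (marginal K hγα.le x) = marginal K (hδγ.trans hγα.le) x :=
                marginal_marginal hγα.le hδγ x
              have h2 : marginal K hδβ (marginal K hβ.le x) = marginal K (hδβ.trans hβ.le) x :=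
                marginal_marginal hβ.le hδβ x
              rw [map_sub, sub_eq_zero]
              change marginal K hδβ (y β hβ) = marginal K hδβ (marginal K hβ.le x)
              rw [h2, hy β δ hβ hδβ, ← hy γ δ hγα hδγ, ← hx γ hγT hγα, h1]
            -- The intersection need not belong to `𝒜` here; over the empty set a marginal is just
            -- the coordinate sum, which is zero. This is why the restricted sheaf is used.
            · have : IsEmpty (β.1 ∩ γ.1 : Finset I) := by
                rw [Finset.not_nonempty_iff_eq_empty.1 hne]
                infer_instance
              refine eq_zero_of_coordSum_eq_zero ?_
              rw [marginal, coordSum_lmapDomain, hd0]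
          rw [marginal_padLinear, hzero, map_zero, add_zero, hx γ hγT hγα]
  obtain ⟨x, hx0, hx⟩ := main Finset.univ
  exact ⟨⟨x, hx0⟩, fun β hβ => Subtype.ext (hx β (Finset.mem_univ _) hβ)⟩

end Free

end

/-! ### The main theorem. -/

theorem theorem5 (K : Type*) [Field K] {I : Type*} [DecidableEq I] (𝒜 : Finset (Finset I))
    (h𝒜 : WeakIntersectionProperty 𝒜)
    (E : I → Type*) [∀ i, Finite (E i)] [∀ i, Nonempty (E i)] :
    -- the Euler characteristic of the free sheaf is well defined and given by the index formula
    (freeCopresheaf K 𝒜 E).HasFiniteCechCohomology ∧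
    (freeCopresheaf K 𝒜 E).cechEuler =
      ∑ α : 𝒜, ∑ β : 𝒜, moebiusCoeff 𝒜 α β * (Nat.card (Outcome E β.1) : ℤ) ∧
    -- it is also the dimension of the sections of the restricted free sheaf plus `χ(𝒜)`
    FiniteDimensional K ((restrictedFreeCopresheaf K 𝒜 E).CechH 0) ∧
    (freeCopresheaf K 𝒜 E).cechEuler =
      (Module.finrank K ((restrictedFreeCopresheaf K 𝒜 E).CechH 0) : ℤ) + posetEuler 𝒜 ∧
    -- `χ(𝒜)` is the Čech Euler characteristic for the lower Alexandrov topology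
    (Copresheaf.const K 𝒜).HasFiniteCechCohomology ∧
    (Copresheaf.const K 𝒜).cechEuler = posetEuler 𝒜 ∧
    -- and for the upper one, which is the lower one of the opposite poset
    (Copresheaf.const K (𝒜)ᵒᵈ).HasFiniteCechCohomology ∧
    (Copresheaf.const K (𝒜)ᵒᵈ).cechEuler = posetEuler 𝒜 ∧
    -- and the Euler characteristic of the nerve
    nerveEuler 𝒜 = posetEuler 𝒜 := by
  have hP := h𝒜.hasBoundedInf
  obtain ⟨f, hf⟩ := Copresheaf.exists_hasIndex hP (freeCopresheaf_isFinite K E 𝒜)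
  obtain ⟨g, hg⟩ := Copresheaf.exists_hasIndex hP (Copresheaf.const_isFinite (K := K) (P := 𝒜))
  obtain ⟨g', hg'⟩ := Copresheaf.exists_hasIndex hP.dual
    (Copresheaf.const_isFinite (K := K) (P := (𝒜)ᵒᵈ))
  have hfree := hf.cechEuler_eq_sum_mu
  simp only [finrank_freeCopresheaf] at hfree
  have hχ : (Copresheaf.const K 𝒜).cechEuler = posetEuler 𝒜 := by
    rw [hg.cechEuler_eq_sum_mu]
    simp only [Copresheaf.finrank_const, Nat.cast_one, mul_one]
    rfl
  refine ⟨hf.finite, hfree, (restrictedFreeCopresheaf_isFinite K E 𝒜).cechH 0, ?_, hg.finite, hχ,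
    hg'.finite, ?_, ?_⟩
  · rw [(restrictedFreeCopresheaf_isExtendable K E 𝒜 h𝒜).finrank_cechH_zero
      (restrictedFreeCopresheaf_isFinite K E 𝒜), hfree, posetEuler, ← Finset.sum_add_distrib]
    refine Finset.sum_congr rfl fun α _ => ?_
    rw [← Finset.sum_add_distrib]
    refine Finset.sum_congr rfl fun β _ => ?_
    -- The two values at `β` differ by one dimension, which accounts for the summand `posetEuler`.
    have h : Module.finrank K ((restrictedFreeCopresheaf K 𝒜 E).obj β) + 1 =
      Nat.card (Outcome E β.1) := finrank_ker_coordSum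
    rw [← h, moebiusCoeff]
    push_cast
    ring
  -- Duality exchanges the two arguments of the Möbius function, hence the exchange of sums.
  · rw [hg'.cechEuler_eq_sum_mu, posetEuler, Finset.sum_comm]
    simp only [Copresheaf.finrank_const, Nat.cast_one, mul_one]
    refine Fintype.sum_equiv OrderDual.ofDual _ _ fun α =>
      Fintype.sum_equiv OrderDual.ofDual _ _ fun β => ?_
    exact IncidenceAlgebra.mu_toDual ℤ (OrderDual.ofDual α) (OrderDual.ofDual β)
  · have h1 : zetaSum g = fun _ => 1 := funext fun b => by
      rw [← hg.finrank_eq, Copresheaf.finrank_const, Nat.cast_one]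
    rw [← hχ, hg.cechEuler_eq, ← sum_chainSum_zetaSum, h1, nerveEuler, Fintype.card_coe]
    simp only [chainSum_one]
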